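/- Let $A\in\mathbb R^{n\times n}$, $B\in\mathbb R^{n\times m}$, $C\in\mathbb R^{p\times n}$, and consider $N$ agents with dynamics $\dot x_i=Ax_i+Bu_i$, $y_i=Cx_i$ $(i=1,\dots,N)$ on $[t_0,\infty)$, together with weights $a_1,\dots,a_N>0$. Suppose that $(A,B)$ is stabilizable, that $(A,C)$ is detectable, and that $A$ has no eigenvalue on the imaginary axis. Then, among the positive semidefinite solutions $P$ of the Riccati equation $$-A^TP-PA+PBB^TP=0$$ there is a largest one, $P_0$, and among the negative semidefinite solutions $Q'$ of $$AQ'+Q'A^T=-Q'C^TCQ'$$ there is a smallest one, $Q$ (both with respect to the Loewner order of symmetric matrices). If the dynamic output control law $$u_i=-B^TP_0\hat\delta_i,\qquad \dot{\hat\delta}_i=(A-BB^TP_0)\hat\delta_i-QC^T\Big(\frac{1}{\sum_{j=1}^Na_j}\sum_{j=1}^Na_j(y_i-y_j)-C\hat\delta_i\Big),\qquad i=1,\dots,N,$$ is used, then the system reaches asymptotic consensus in the outputs: for all initial values $x_i(t_0)$ and $\hat\delta_i(t_0)$ and all $i\ne j$, $$\lim_{t\to\infty}\big(y_i(t)-y_j(t)\big)=0.$$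 -/

import Mathlib

open Matrix Filter Topology

namespace OutputConsensus

/-- A real square matrix is Hurwitz if all its complex eigenvalues have negative real part. -/
def IsHurwitz {n : ℕ} (A : Matrix (Fin n) (Fin n) ℝ) : Prop :=
  ∀ z ∈ spectrum ℂ (A.map Complex.ofReal), z.re < 0

/-- `(A, B)` is stabilizable: some state feedback `u = K x` makes `A + B K` Hurwitz. -/
def IsStabilizable {n m : ℕ} (A : Matrix (Fin n) (Fin n) ℝ) (B : Matrix (Fin n) (Fin m) ℝ) :
    Prop :=
  ∃ K : Matrix (Fin m) (Fin n) ℝ, IsHurwitz (A + B * K)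

/-- `(A, C)` is detectable: some output injection `L` makes `A + L C` Hurwitz. -/
def IsDetectable {n p : ℕ} (A : Matrix (Fin n) (Fin n) ℝ) (C : Matrix (Fin p) (Fin n) ℝ) :
    Prop :=
  ∃ L : Matrix (Fin n) (Fin p) ℝ, IsHurwitz (A + L * C)

/-- `A` has no complex eigenvalue on the imaginary axis. -/
def NoImaginaryAxisEigenvalue {n : ℕ} (A : Matrix (Fin n) (Fin n) ℝ) : Prop :=
  ∀ z ∈ spectrum ℂ (A.map Complex.ofReal), z.re ≠ 0

/-- `P` is symmetric positive semidefinite and `-Aᵀ P - P A + P B Bᵀ P = 0`. -/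
def IsControlRiccatiSolution {n m : ℕ} (A : Matrix (Fin n) (Fin n) ℝ)
    (B : Matrix (Fin n) (Fin m) ℝ) (P : Matrix (Fin n) (Fin n) ℝ) : Prop :=
  P.PosSemidef ∧ -(Aᵀ * P) - P * A + P * B * Bᵀ * P = 0

/-- `Q` is symmetric negative semidefinite and `A Q + Q Aᵀ = -Q Cᵀ C Q`. -/
def IsObserverRiccatiSolution {n p : ℕ} (A : Matrix (Fin n) (Fin n) ℝ)
    (C : Matrix (Fin p) (Fin n) ℝ) (Q : Matrix (Fin n) (Fin n) ℝ) : Prop :=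
  (-Q).PosSemidef ∧ A * Q + Q * Aᵀ = -(Q * Cᵀ * C * Q)

/-- The controller matrix `P₀`: the largest positive semidefinite solution of the control
Riccati equation, in the Loewner order. (The equation always has the solution `0` as well.) -/
def IsControlMatrix {n m : ℕ} (A : Matrix (Fin n) (Fin n) ℝ)
    (B : Matrix (Fin n) (Fin m) ℝ) (P₀ : Matrix (Fin n) (Fin n) ℝ) : Prop :=
  IsControlRiccatiSolution A B P₀ ∧
    ∀ P, IsControlRiccatiSolution A B P → (P₀ - P).PosSemidef

/-- The observer matrix `Q`: the smallest negative semidefinite solution of the observer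
Riccati equation, in the Loewner order. -/
def IsObserverMatrix {n p : ℕ} (A : Matrix (Fin n) (Fin n) ℝ)
    (C : Matrix (Fin p) (Fin n) ℝ) (Q : Matrix (Fin n) (Fin n) ℝ) : Prop :=
  IsObserverRiccatiSolution A C Q ∧
    ∀ Q', IsObserverRiccatiSolution A C Q' → (Q' - Q).PosSemidef

/-- `x, u, y` are states, inputs and outputs of `N` identical agents
`ẋᵢ = A xᵢ + B uᵢ`, `yᵢ = C xᵢ` on `[t₀, ∞)`. -/
structure IsAgentTrajectory {N n m p : ℕ} (A : Matrix (Fin n) (Fin n) ℝ)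
    (B : Matrix (Fin n) (Fin m) ℝ) (C : Matrix (Fin p) (Fin n) ℝ) (t₀ : ℝ)
    (x : Fin N → ℝ → Fin n → ℝ) (u : Fin N → ℝ → Fin m → ℝ) (y : Fin N → ℝ → Fin p → ℝ) :
    Prop where
  state_eq : ∀ i, ∀ t, t₀ ≤ t →
    HasDerivWithinAt (x i) (A *ᵥ x i t + B *ᵥ u i t) (Set.Ici t₀) t
  output_eq : ∀ i, ∀ t, t₀ ≤ t → y i t = C *ᵥ x i t

/-- `u` is produced from the outputs `y` by the dynamic output control law with internal
(observer) states `δ` and weights `a`: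
`uᵢ = -Bᵀ P₀ δᵢ`,
`δ̇ᵢ = (A - B Bᵀ P₀) δᵢ - Q Cᵀ ((∑ⱼ aⱼ)⁻¹ ∑ⱼ aⱼ (yᵢ - yⱼ) - C δᵢ)`. -/
structure IsOutputControlLaw {N n m p : ℕ} (A : Matrix (Fin n) (Fin n) ℝ)
    (B : Matrix (Fin n) (Fin m) ℝ) (C : Matrix (Fin p) (Fin n) ℝ)
    (P₀ Q : Matrix (Fin n) (Fin n) ℝ) (a : Fin N → ℝ) (t₀ : ℝ)
    (y : Fin N → ℝ → Fin p → ℝ) (δ : Fin N → ℝ → Fin n → ℝ) (u : Fin N → ℝ → Fin m → ℝ) :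
    Prop where
  input_eq : ∀ i, ∀ t, t₀ ≤ t → u i t = -((Bᵀ * P₀) *ᵥ δ i t)
  observer_eq : ∀ i, ∀ t, t₀ ≤ t →
    HasDerivWithinAt (δ i)
      ((A - B * Bᵀ * P₀) *ᵥ δ i t -
        (Q * Cᵀ) *ᵥ ((∑ j, a j)⁻¹ • (∑ j, a j • (y i t - y j t)) - C *ᵥ δ i t))
      (Set.Ici t₀) t

end OutputConsensus

/-!
The largest solution of the control Riccati equation is obtained by the Kleinman iteration. Starting
from a stabilizing gain `K`, solve the Lyapunov equation
`(A - B K)ᵀ P + P (A - B K) = -Kᵀ K` for `P ≥ 0` and replace `K` by `Bᵀ P`. Completing the square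
shows that the new gain is again stabilizing (`IsStable.update`), that the matrices `P` decrease in
the Loewner order, and that each of them dominates every symmetric solution of the Riccati equation.
Their limit `P₀` is therefore the largest solution. The eigenvalues of `A - B Bᵀ P₀`, a limit of
stable matrices, lie in the closed left half-plane (`re_nonpos_of_tendsto_isStable`), and an
eigenvalue on the imaginary axis would be an eigenvalue of `A`; so `A - B Bᵀ P₀` is stable
(`exists_maximal_riccati`). The observer matrix `Q` is minus the control matrix of the dual pair
`(Aᵀ, Cᵀ)` (`observerMatrix_iff`), which makes `A + Q Cᵀ C` stable.

For consensus, fix two agents and put `z = δ i - δ j`, `w = (x i - x j) - z`. The weighted averages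
cancel in the difference of the two measurements, and
`ż = (A - B Bᵀ P₀) z - Q Cᵀ C w`, `ẇ = (A + Q Cᵀ C) w`.
This system is block triangular with stable diagonal blocks, so `z` and `w` tend to zero, and with
them `y i - y j = C (z + w)` (`tendsto_output_sub`).
Only differences of observer states enter, so stability of `A - B Bᵀ P₀ + Q Cᵀ C`, which governs the
weighted mean of the `δ i`, plays no role.

The analytic ingredient for the Lyapunov equations and for consensus is that solutions of `ẋ = M x`
with stable `M` tend to zero (`IsStable.tendsto_zero`). It follows from Gelfand's formula, because
every eigenvalue of `exp M` is the exponential of an eigenvalue of `M`.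
-/

namespace OutputConsensus

/-! ### Stable matrices and decay of solutions -/

section Stability

open scoped Matrix.Norms.Operator

variable {ι : Type*} [Fintype ι]

theorem hasDerivWithinAt_matrix_entry {R : Type*} [RCLike R]
    {E : ℝ → Matrix ι ι R} {E' : Matrix ι ι R} {s : Set ℝ} {t : ℝ}
    (hE : HasDerivWithinAt E E' s t) (i j : ι) :
    HasDerivWithinAt (fun t => E t i j) (E' i j) s t :=
  (LinearMap.toContinuousLinearMap
    (Matrix.entryLinearMap ℝ R i j)).hasFDerivAt.comp_hasDerivWithinAt t hE

theorem hasDerivWithinAt_matrix_mulVec {R : Type*} [RCLike R]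
    {E : ℝ → Matrix ι ι R} {E' : Matrix ι ι R}
    {x : ℝ → ι → R} {x' : ι → R} {s : Set ℝ} {t : ℝ} (hE : HasDerivWithinAt E E' s t)
    (hx : HasDerivWithinAt x x' s t) :
    HasDerivWithinAt (fun t => E t *ᵥ x t) (E' *ᵥ x t + E t *ᵥ x') s t := by
  rw [hasDerivWithinAt_pi] at hx ⊢
  intro i
  have := HasDerivWithinAt.fun_sum (u := Finset.univ) fun j _ =>
    (hasDerivWithinAt_matrix_entry hE i j).mul (hx j)
  simpa [Matrix.mulVec, dotProduct, Finset.sum_add_distrib] using this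

variable [DecidableEq ι]

/-- A real square matrix over any finite index type is stable if all its complex eigenvalues have
negative real part. For the index type `Fin n` this is `IsHurwitz`; the general index type is
needed for block matrices. -/
def IsStable (M : Matrix ι ι ℝ) : Prop :=
  ∀ z ∈ spectrum ℂ (M.map Complex.ofReal), z.re < 0

theorem mem_spectrum_iff_exists_mulVec {K : Type*} [Field K] {M : Matrix ι ι K} {z : K} :
    z ∈ spectrum K M ↔ ∃ v : ι → K, v ≠ 0 ∧ M *ᵥ v = z • v := by
  rw [spectrum.mem_iff, Matrix.isUnit_iff_isUnit_det, isUnit_iff_ne_zero, not_not,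
    ← Matrix.exists_mulVec_eq_zero_iff]
  refine exists_congr fun v => and_congr_right fun _ => ?_
  rw [Matrix.sub_mulVec, sub_eq_zero, Algebra.algebraMap_eq_smul_one, Matrix.smul_mulVec,
    Matrix.one_mulVec, eq_comm]

theorem mem_spectrum_map_transpose {M : Matrix ι ι ℝ} {z : ℂ} :
    z ∈ spectrum ℂ (Mᵀ.map Complex.ofReal) ↔ z ∈ spectrum ℂ (M.map Complex.ofReal) := by
  rw [Matrix.mem_spectrum_iff_isRoot_charpoly, Matrix.mem_spectrum_iff_isRoot_charpoly,
    Matrix.transpose_map, Matrix.charpoly_transpose]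

theorem IsStable.transpose {M : Matrix ι ι ℝ} (hM : IsStable M) : IsStable Mᵀ :=
  fun z hz => hM z (mem_spectrum_map_transpose.1 hz)

theorem hasSum_exp (M : Matrix ι ι ℂ) :
    HasSum (fun n : ℕ => ((n.factorial : ℂ)⁻¹) • M ^ n) (NormedSpace.exp M) :=
  NormedSpace.exp_series_hasSum_exp' (𝕂 := ℂ) M

theorem exp_mulVec_of_mulVec_eq_smul {M : Matrix ι ι ℂ} {z : ℂ} {v : ι → ℂ}
    (h : M *ᵥ v = z • v) : NormedSpace.exp M *ᵥ v = Complex.exp z • v := by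
  have hpow : ∀ n : ℕ, M ^ n *ᵥ v = z ^ n • v := by
    intro n
    induction n with
    | zero => simp
    | succ n ih => rw [pow_succ, ← Matrix.mulVec_mulVec, h, Matrix.mulVec_smul, ih, smul_smul,
        pow_succ']
  have h1 : HasSum (fun n : ℕ => (((n.factorial : ℂ)⁻¹) • M ^ n) *ᵥ v)
      (NormedSpace.exp M *ᵥ v) :=
    (hasSum_exp M).map (Matrix.mulVec.addMonoidHomLeft v)
      (by simpa [Matrix.mulVec.addMonoidHomLeft] using
        Continuous.matrix_mulVec continuous_id continuous_const)
  have h2 : HasSum (fun n : ℕ => (((n.factorial : ℂ)⁻¹) • z ^ n) • v) (Complex.exp z • v) := by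
    rw [Complex.exp_eq_exp_ℂ]
    exact (NormedSpace.exp_series_hasSum_exp' (𝕂 := ℂ) z).smul_const v
  refine h1.unique (h2.congr_fun ?_)
  intro n
  rw [Matrix.smul_mulVec, hpow, smul_smul, smul_eq_mul]

/-- Every eigenvalue of `exp M` is the exponential of an eigenvalue of `M`: an eigenspace of
`exp M` is invariant under `M`, so `M` has an eigenvector in it. -/
theorem exists_mem_spectrum_of_mem_spectrum_exp {M : Matrix ι ι ℂ} {μ : ℂ}
    (hμ : μ ∈ spectrum ℂ (NormedSpace.exp M)) : ∃ z ∈ spectrum ℂ M, Complex.exp z = μ := by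
  obtain ⟨v, hv, hEv⟩ := mem_spectrum_iff_exists_mulVec.1 hμ
  set W : Submodule ℂ (ι → ℂ) :=
    LinearMap.ker (Matrix.toLin' (NormedSpace.exp M) - μ • LinearMap.id) with hW
  have memW : ∀ w, w ∈ W ↔ NormedSpace.exp M *ᵥ w = μ • w := by
    intro w
    simp [hW, LinearMap.mem_ker, sub_eq_zero]
  have hinv : ∀ w ∈ W, Matrix.toLin' M w ∈ W := by
    intro w hw
    rw [memW] at hw ⊢
    have hcomm : NormedSpace.exp M * M = M * NormedSpace.exp M :=
      ((Commute.refl M).exp_left).eq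
    rw [Matrix.toLin'_apply, Matrix.mulVec_mulVec, hcomm, ← Matrix.mulVec_mulVec, hw,
      Matrix.mulVec_smul]
  have : Nontrivial W := ⟨⟨⟨v, (memW v).2 hEv⟩, 0, fun h => hv (congrArg Subtype.val h)⟩⟩
  obtain ⟨z, hz⟩ := Module.End.exists_eigenvalue ((Matrix.toLin' M).restrict hinv)
  obtain ⟨w, hw⟩ := hz.exists_hasEigenvector
  have hw0 : (w : ι → ℂ) ≠ 0 := fun h => hw.2 (Subtype.ext h)
  have hMw : M *ᵥ (w : ι → ℂ) = z • (w : ι → ℂ) := by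
    have := congrArg Subtype.val hw.apply_eq_smul
    simpa using this
  refine ⟨z, mem_spectrum_iff_exists_mulVec.2 ⟨w, hw0, hMw⟩, ?_⟩
  have h3 := (memW w).1 w.2
  rw [exp_mulVec_of_mulVec_eq_smul hMw] at h3
  exact smul_left_injective ℂ hw0 h3

/-- By Gelfand's formula, the powers of an element of spectral radius less than one tend to
zero. -/
theorem tendsto_pow_of_spectralRadius_lt_one {𝔸 : Type*} [NormedRing 𝔸] [NormedAlgebra ℂ 𝔸]
    [CompleteSpace 𝔸] {E : 𝔸} (hE : spectralRadius ℂ E < 1) :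
    Tendsto (fun n : ℕ => E ^ n) atTop (𝓝 0) := by
  obtain ⟨r, hr1, hr2⟩ := exists_between hE
  have hr := (spectrum.pow_nnnorm_pow_one_div_tendsto_nhds_spectralRadius E).eventually_lt_const hr1
  have hle : ∀ᶠ n : ℕ in atTop, ‖E ^ n‖ₑ ≤ r ^ n := by
    filter_upwards [hr, eventually_gt_atTop 0] with n hn hn0
    have := pow_le_pow_left' hn.le n
    rwa [← ENNReal.rpow_natCast, ← ENNReal.rpow_mul, one_div,
      inv_mul_cancel₀ (by positivity), ENNReal.rpow_one] at this
  rw [tendsto_zero_iff_enorm_tendsto_zero]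
  exact tendsto_of_tendsto_of_tendsto_of_le_of_le' tendsto_const_nhds
    (ENNReal.tendsto_pow_atTop_nhds_zero_of_lt_one hr2) (Eventually.of_forall fun _ => zero_le)
    hle

theorem spectralRadius_exp_lt_one {M : Matrix ι ι ℂ} (hM : ∀ z ∈ spectrum ℂ M, z.re < 0) :
    spectralRadius ℂ (NormedSpace.exp M) < 1 := by
  rcases (spectrum ℂ (NormedSpace.exp M)).eq_empty_or_nonempty with h | h
  · simp [spectralRadius, h]
  · refine spectrum.spectralRadius_lt_of_forall_lt_of_nonempty h (r := 1) ?_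
    intro μ hμ
    obtain ⟨z, hz, rfl⟩ := exists_mem_spectrum_of_mem_spectrum_exp hμ
    rw [← NNReal.coe_lt_coe, coe_nnnorm, Complex.norm_exp]
    simpa using hM z hz

/-- With `n = ⌊t⌋₊`, the exponential splits as `exp (t M) = (exp M) ^ n * exp ((t - n) M)`; the last
factor is bounded, because `t - n` lies in `[0, 1]`. -/
theorem tendsto_exp_smul_of_spectralRadius_lt_one {𝔸 : Type*} [NormedRing 𝔸] [NormedAlgebra ℂ 𝔸]
    [CompleteSpace 𝔸] {M : 𝔸} (hM : spectralRadius ℂ (NormedSpace.exp M) < 1) :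
    Tendsto (fun t : ℝ => NormedSpace.exp (t • M)) atTop (𝓝 0) := by
  let _ : NormedAlgebra ℚ 𝔸 := .restrictScalars ℚ ℂ 𝔸
  have hsplit : ∀ t : ℝ, NormedSpace.exp (t • M) =
      NormedSpace.exp M ^ ⌊t⌋₊ * NormedSpace.exp ((t - ⌊t⌋₊) • M) := by
    intro t
    have hcomm : Commute (⌊t⌋₊ • M) ((t - ⌊t⌋₊) • M) :=
      ((Commute.refl M).smul_right _).smul_left _
    have hsum : t • M = ⌊t⌋₊ • M + (t - ⌊t⌋₊) • M := by
      rw [← Nat.cast_smul_eq_nsmul ℝ, ← add_smul, add_sub_cancel]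
    rw [hsum, NormedSpace.exp_add_of_commute hcomm, NormedSpace.exp_nsmul]
  have hcont : Continuous fun t : ℝ => NormedSpace.exp (t • M) :=
    NormedSpace.exp_continuous.comp (continuous_id.smul continuous_const)
  obtain ⟨c, hc⟩ := (isCompact_Icc (a := (0 : ℝ)) (b := 1)).exists_bound_of_continuousOn
    hcont.continuousOn
  have hpow : Tendsto (fun t : ℝ => NormedSpace.exp M ^ ⌊t⌋₊) atTop (𝓝 0) :=
    (tendsto_pow_of_spectralRadius_lt_one hM).comp tendsto_nat_floor_atTop
  have hlim : Tendsto (fun t : ℝ => ‖NormedSpace.exp M ^ ⌊t⌋₊‖ * c) atTop (𝓝 0) := by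
    simpa using (tendsto_zero_iff_norm_tendsto_zero.1 hpow).mul_const c
  refine squeeze_zero_norm' ?_ hlim
  filter_upwards [eventually_ge_atTop 0] with t ht
  rw [hsplit]
  refine (norm_mul_le _ _).trans (mul_le_mul_of_nonneg_left (hc _ ?_) (norm_nonneg _))
  exact ⟨sub_nonneg.2 (Nat.floor_le ht), by linarith [Nat.lt_floor_add_one t]⟩

theorem tendsto_exp_smul {M : Matrix ι ι ℂ} (hM : ∀ z ∈ spectrum ℂ M, z.re < 0) :
    Tendsto (fun t : ℝ => NormedSpace.exp (t • M)) atTop (𝓝 0) :=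
  tendsto_exp_smul_of_spectralRadius_lt_one (spectralRadius_exp_lt_one hM)

theorem hasDerivAt_exp_neg_smul (M : Matrix ι ι ℂ) (t₀ t : ℝ) :
    HasDerivAt (fun t : ℝ => NormedSpace.exp ((t₀ - t) • M))
      (-(NormedSpace.exp ((t₀ - t) • M) * M)) t := by
  have h := (hasDerivAt_exp_smul_const (𝕂 := ℝ) M (t₀ - t)).scomp t
    ((hasDerivAt_id t).const_sub t₀)
  exact h.congr_deriv (neg_one_smul ℝ _)

theorem eq_of_hasDerivWithinAt_zero {F : Type*} [NormedAddCommGroup F] [NormedSpace ℝ F]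
    {f : ℝ → F} {t₀ : ℝ} (hf : ∀ t, t₀ ≤ t → HasDerivWithinAt f 0 (Set.Ici t₀) t)
    {t : ℝ} (ht : t₀ ≤ t) : f t = f t₀ := by
  refine constant_of_has_deriv_right_zero (f := f) (a := t₀) (b := t)
    (fun s hs => ((hf s hs.1).continuousWithinAt).mono Set.Icc_subset_Ici_self)
    (fun s hs => (hf s hs.1).mono (Set.Ici_subset_Ici.2 hs.1)) t ⟨ht, le_rfl⟩

/-- Uniqueness of solutions on a half-line: `exp ((t₀ - t) M) x(t)` has zero derivative. -/
theorem eq_exp_mulVec_of_hasDerivWithinAt {M : Matrix ι ι ℂ} {t₀ : ℝ} {x : ℝ → ι → ℂ}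
    (hx : ∀ t, t₀ ≤ t → HasDerivWithinAt x (M *ᵥ x t) (Set.Ici t₀) t) {t : ℝ} (ht : t₀ ≤ t) :
    x t = NormedSpace.exp ((t - t₀) • M) *ᵥ x t₀ := by
  have hconst := eq_of_hasDerivWithinAt_zero
    (f := fun s => NormedSpace.exp ((t₀ - s) • M) *ᵥ x s) (t₀ := t₀) (fun s hs => by
      have := hasDerivWithinAt_matrix_mulVec
        (hasDerivAt_exp_neg_smul M t₀ s).hasDerivWithinAt (hx s hs)
      rwa [Matrix.neg_mulVec, ← Matrix.mulVec_mulVec, neg_add_cancel] at this) ht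
  simp only [sub_self, zero_smul, NormedSpace.exp_zero, Matrix.one_mulVec] at hconst
  have hcomm : Commute ((t - t₀) • M) ((t₀ - t) • M) :=
    ((Commute.refl M).smul_right _).smul_left _
  rw [← hconst, Matrix.mulVec_mulVec, ← Matrix.exp_add_of_commute _ _ hcomm, ← add_smul]
  simp

/-- Solutions of `ẋ = M x` on a half-line tend to zero when `M` is stable. -/
theorem IsStable.tendsto_zero {M : Matrix ι ι ℝ} (hM : IsStable M) {t₀ : ℝ} {x : ℝ → ι → ℝ}
    (hx : ∀ t, t₀ ≤ t → HasDerivWithinAt x (M *ᵥ x t) (Set.Ici t₀) t) :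
    Tendsto x atTop (𝓝 0) := by
  have hz : ∀ t, t₀ ≤ t → HasDerivWithinAt (fun s i => (x s i : ℂ))
      (M.map Complex.ofReal *ᵥ fun i => (x t i : ℂ)) (Set.Ici t₀) t := by
    intro t ht
    rw [hasDerivWithinAt_pi]
    intro i
    have h := (hasDerivWithinAt_pi.1 (hx t ht) i).ofReal_comp
    refine h.congr_deriv ?_
    simp [Matrix.mulVec, dotProduct]
  have hlim : Tendsto (fun t : ℝ => NormedSpace.exp ((t - t₀) • M.map Complex.ofReal) *ᵥ
      fun i => (x t₀ i : ℂ)) atTop (𝓝 (0 *ᵥ fun i => (x t₀ i : ℂ))) :=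
    ((Continuous.matrix_mulVec continuous_id continuous_const).tendsto
      (0 : Matrix ι ι ℂ)).comp ((tendsto_exp_smul hM).comp
        (tendsto_atTop_add_const_right _ (-t₀) tendsto_id))
  rw [Matrix.zero_mulVec, tendsto_pi_nhds] at hlim
  rw [tendsto_pi_nhds]
  intro i
  have h := (Complex.continuous_re.tendsto _).comp (hlim i)
  refine h.congr' ?_
  filter_upwards [eventually_ge_atTop t₀] with t ht
  have := congrFun (eq_exp_mulVec_of_hasDerivWithinAt hz ht) i
  simp only [Function.comp_apply, ← this, Complex.ofReal_re]

theorem exists_solution (M : Matrix ι ι ℝ) (v : ι → ℝ) :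
    ∃ x : ℝ → ι → ℝ, x 0 = v ∧ ∀ t, HasDerivAt x (M *ᵥ x t) t := by
  refine ⟨fun t => NormedSpace.exp (t • M) *ᵥ v, by simp, fun t => ?_⟩
  have h := hasDerivWithinAt_matrix_mulVec
    (hasDerivAt_exp_smul_const' (𝕂 := ℝ) M t).hasDerivWithinAt
    (hasDerivWithinAt_const t Set.univ v)
  rw [hasDerivWithinAt_univ] at h
  exact h.congr_deriv (by simp only [Matrix.mulVec_zero, add_zero, Matrix.mulVec_mulVec]; rfl)

end Stability

/-! ### Quadratic forms along solutions -/

section Lyapunov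

variable {ι κ : Type*} [Fintype ι] [Fintype κ]

theorem posSemidef_iff_real {P : Matrix ι ι ℝ} :
    P.PosSemidef ↔ Pᵀ = P ∧ ∀ v : ι → ℝ, 0 ≤ v ⬝ᵥ P *ᵥ v := by
  rw [Matrix.posSemidef_iff_dotProduct_mulVec]
  simp [Matrix.IsHermitian, Matrix.conjTranspose_eq_transpose_of_trivial]

theorem posSemidef_transpose_mul_self (K : Matrix κ ι ℝ) : (Kᵀ * K).PosSemidef := by
  simpa [Matrix.conjTranspose_eq_transpose_of_trivial] using
    Matrix.posSemidef_conjTranspose_mul_self K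

theorem dotProduct_mulVec_of_transpose_eq {P : Matrix ι ι ℝ} (hP : Pᵀ = P) (v w : ι → ℝ) :
    v ⬝ᵥ P *ᵥ w = w ⬝ᵥ P *ᵥ v := by
  rw [Matrix.dotProduct_mulVec, ← Matrix.mulVec_transpose, hP, dotProduct_comm]

theorem dotProduct_lyapunov_mulVec (M P : Matrix ι ι ℝ) (v w : ι → ℝ) :
    v ⬝ᵥ (Mᵀ * P + P * M) *ᵥ w = (M *ᵥ v) ⬝ᵥ P *ᵥ w + v ⬝ᵥ P *ᵥ (M *ᵥ w) := by
  rw [Matrix.add_mulVec, dotProduct_add, ← Matrix.mulVec_mulVec, ← Matrix.mulVec_mulVec,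
    Matrix.dotProduct_mulVec v, Matrix.vecMul_transpose]

theorem eq_zero_of_dotProduct_mulVec_eq_zero {P : Matrix ι ι ℝ}
    (h : ∀ v w : ι → ℝ, v ⬝ᵥ P *ᵥ w = 0) : P = 0 := by
  classical
  ext i j
  simpa using h (Pi.single i 1) (Pi.single j 1)

theorem hasDerivAt_dotProduct_mulVec (M P : Matrix ι ι ℝ) {x y : ℝ → ι → ℝ} {t : ℝ}
    (hx : HasDerivAt x (M *ᵥ x t) t) (hy : HasDerivAt y (M *ᵥ y t) t) :
    HasDerivAt (fun t => x t ⬝ᵥ P *ᵥ y t) (x t ⬝ᵥ (Mᵀ * P + P * M) *ᵥ y t) t := by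
  have hPy : HasDerivAt (fun t => P *ᵥ y t) (P *ᵥ (M *ᵥ y t)) t :=
    (LinearMap.toContinuousLinearMap (Matrix.mulVecLin P)).hasFDerivAt.comp_hasDerivAt t hy
  rw [dotProduct_lyapunov_mulVec]
  have := HasDerivAt.fun_sum (u := Finset.univ) fun i _ =>
    (hasDerivAt_pi.1 hx i).mul (hasDerivAt_pi.1 hPy i)
  simpa [dotProduct, Finset.sum_add_distrib] using this

theorem tendsto_dotProduct_mulVec_zero (P : Matrix ι ι ℝ) {x y : ℝ → ι → ℝ}
    (hx : Tendsto x atTop (𝓝 0)) (hy : Tendsto y atTop (𝓝 0)) :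
    Tendsto (fun t => x t ⬝ᵥ P *ᵥ y t) atTop (𝓝 0) := by
  have hc : Continuous fun p : (ι → ℝ) × (ι → ℝ) => p.1 ⬝ᵥ P *ᵥ p.2 :=
    continuous_fst.dotProduct (Continuous.matrix_mulVec continuous_const continuous_snd)
  simpa [Function.comp_def] using (hc.tendsto (0, 0)).comp (hx.prodMk_nhds hy)

/-! ### Monotone limits of positive semidefinite matrices -/

/-- The quadratic forms converge by monotonicity, and the entries are recovered from them by
polarization. -/
theorem exists_tendsto_of_antitone_posSemidef {P : ℕ → Matrix ι ι ℝ}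
    (hP : ∀ k, (P k).PosSemidef) (hanti : ∀ k, (P k - P (k + 1)).PosSemidef) :
    ∃ L, Tendsto P atTop (𝓝 L) := by
  classical
  have hq : ∀ v : ι → ℝ, ∃ l, Tendsto (fun k => v ⬝ᵥ P k *ᵥ v) atTop (𝓝 l) := by
    intro v
    refine ⟨_, tendsto_atTop_ciInf (antitone_nat_of_succ_le fun k => ?_)
      ⟨0, ?_⟩⟩
    · have := (posSemidef_iff_real.1 (hanti k)).2 v
      rwa [Matrix.sub_mulVec, dotProduct_sub, sub_nonneg] at this
    · rintro _ ⟨k, rfl⟩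
      exact (posSemidef_iff_real.1 (hP k)).2 v
  choose q hq using hq
  have hpol : ∀ k i j, P k i j = ((Pi.single i 1 + Pi.single j 1) ⬝ᵥ
      P k *ᵥ (Pi.single i 1 + Pi.single j 1) - Pi.single i 1 ⬝ᵥ P k *ᵥ Pi.single i 1 -
        Pi.single j 1 ⬝ᵥ P k *ᵥ Pi.single j 1) / 2 := by
    intro k i j
    have hij : P k j i = P k i j := congrFun (congrFun (posSemidef_iff_real.1 (hP k)).1 i) j
    simp only [Matrix.mulVec_add, dotProduct_add, add_dotProduct, Matrix.mulVec_single_one,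
      single_one_dotProduct, Matrix.col_apply, hij]
    ring
  refine ⟨fun i j => (q (Pi.single i 1 + Pi.single j 1) - q (Pi.single i 1) -
    q (Pi.single j 1)) / 2, ?_⟩
  refine tendsto_pi_nhds.2 fun i => tendsto_pi_nhds.2 fun j => ?_
  simp only [hpol _ i j]
  exact (((hq _).sub (hq _)).sub (hq _)).div_const 2

theorem posSemidef_of_tendsto {P : ℕ → Matrix ι ι ℝ} {L : Matrix ι ι ℝ}
    (hP : ∀ k, (P k).PosSemidef) (hL : Tendsto P atTop (𝓝 L)) : L.PosSemidef := by
  refine posSemidef_iff_real.2 ⟨?_, fun v => ?_⟩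
  · refine tendsto_nhds_unique ?_ hL
    exact ((continuous_id.matrix_transpose.tendsto L).comp hL).congr
      fun k => (posSemidef_iff_real.1 (hP k)).1
  · have hc : Continuous fun X : Matrix ι ι ℝ => v ⬝ᵥ X *ᵥ v :=
      continuous_const.dotProduct (Continuous.matrix_mulVec continuous_id continuous_const)
    exact ge_of_tendsto' ((hc.tendsto L).comp hL) fun k => (posSemidef_iff_real.1 (hP k)).2 v

/-! ### Lyapunov equations -/

/-- If `P ≥ 0` and `Mᵀ P + P M ≤ -Kᵀ K`, then `K` annihilates every eigenvector of `M` for an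
eigenvalue in the closed right half-plane. The eigenvector enters through its real and imaginary
parts. -/
theorem mulVec_eq_zero_of_lyapunov {M P : Matrix ι ι ℝ} {K : Matrix κ ι ℝ} (hP : P.PosSemidef)
    (hMP : (-(Mᵀ * P + P * M) - Kᵀ * K).PosSemidef) {σ ω : ℝ} (hσ : 0 ≤ σ) {v w : ι → ℝ}
    (hv : M *ᵥ v = σ • v - ω • w) (hw : M *ᵥ w = ω • v + σ • w) :
    K *ᵥ v = 0 ∧ K *ᵥ w = 0 := by
  obtain ⟨hsymm, hnonneg⟩ := posSemidef_iff_real.1 hP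
  have hle : ∀ u, (K *ᵥ u) ⬝ᵥ (K *ᵥ u) ≤ -(2 * ((M *ᵥ u) ⬝ᵥ P *ᵥ u)) := by
    intro u
    have h := (posSemidef_iff_real.1 hMP).2 u
    rw [Matrix.sub_mulVec, Matrix.neg_mulVec, dotProduct_sub, dotProduct_neg,
      dotProduct_lyapunov_mulVec, dotProduct_mulVec_of_transpose_eq hsymm u,
      ← Matrix.mulVec_mulVec, Matrix.dotProduct_mulVec u, Matrix.vecMul_transpose] at h
    linarith
  have hsum : (M *ᵥ v) ⬝ᵥ P *ᵥ v + (M *ᵥ w) ⬝ᵥ P *ᵥ w =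
      σ * (v ⬝ᵥ P *ᵥ v + w ⬝ᵥ P *ᵥ w) := by
    rw [hv, hw, sub_dotProduct, add_dotProduct]
    simp only [smul_dotProduct, smul_eq_mul]
    rw [dotProduct_mulVec_of_transpose_eq hsymm w v]
    ring
  have hpos := mul_nonneg hσ (add_nonneg (hnonneg v) (hnonneg w))
  have h1 := hle v
  have h2 := hle w
  have h3 : 0 ≤ (K *ᵥ v) ⬝ᵥ (K *ᵥ v) := Finset.sum_nonneg fun i _ => mul_self_nonneg _
  have h4 : 0 ≤ (K *ᵥ w) ⬝ᵥ (K *ᵥ w) := Finset.sum_nonneg fun i _ => mul_self_nonneg _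
  exact ⟨dotProduct_self_eq_zero.1 (by linarith), dotProduct_self_eq_zero.1 (by linarith)⟩

variable [DecidableEq ι]

/-- Along solutions `x`, `y` of `ẋ = M x`, the bilinear form `x ⬝ P y` is constant and tends to
zero. -/
theorem IsStable.lyapunov_injective {M : Matrix ι ι ℝ} (hM : IsStable M) {P : Matrix ι ι ℝ}
    (hP : Mᵀ * P + P * M = 0) : P = 0 := by
  refine eq_zero_of_dotProduct_mulVec_eq_zero fun v w => ?_
  obtain ⟨x, rfl, hx⟩ := exists_solution M v
  obtain ⟨y, rfl, hy⟩ := exists_solution M w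
  have hconst : ∀ t, 0 ≤ t → x t ⬝ᵥ P *ᵥ y t = x 0 ⬝ᵥ P *ᵥ y 0 := fun t ht =>
    eq_of_hasDerivWithinAt_zero (f := fun t => x t ⬝ᵥ P *ᵥ y t) (t₀ := 0) (fun s _ => by
      have := hasDerivAt_dotProduct_mulVec M P (hx s) (hy s)
      rw [hP, Matrix.zero_mulVec, dotProduct_zero] at this
      exact this.hasDerivWithinAt) ht
  have hlim := tendsto_dotProduct_mulVec_zero P
    (hM.tendsto_zero (t₀ := 0) fun t _ => (hx t).hasDerivWithinAt)
    (hM.tendsto_zero (t₀ := 0) fun t _ => (hy t).hasDerivWithinAt)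
  refine tendsto_nhds_unique (tendsto_const_nhds.congr' ?_) hlim
  filter_upwards [eventually_ge_atTop 0] with t ht using (hconst t ht).symm

/-- Along a solution `x` of `ẋ = M x`, the function `x ⬝ P x` decreases to zero, so it is
nonnegative. -/
theorem IsStable.posSemidef_of_lyapunov {M : Matrix ι ι ℝ} (hM : IsStable M) {P : Matrix ι ι ℝ}
    (hPsymm : Pᵀ = P) (hP : (-(Mᵀ * P + P * M)).PosSemidef) : P.PosSemidef := by
  refine posSemidef_iff_real.2 ⟨hPsymm, fun v => ?_⟩
  obtain ⟨x, rfl, hx⟩ := exists_solution M v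
  have hderiv := fun t => hasDerivAt_dotProduct_mulVec M P (hx t) (hx t)
  have hanti : Antitone fun t => x t ⬝ᵥ P *ᵥ x t := by
    refine antitone_of_hasDerivAt_nonpos hderiv fun t => ?_
    have := (posSemidef_iff_real.1 hP).2 (x t)
    rwa [Matrix.neg_mulVec, dotProduct_neg, neg_nonneg] at this
  have hlim := hM.tendsto_zero (t₀ := 0) fun t _ => (hx t).hasDerivWithinAt
  exact hanti.le_of_tendsto (tendsto_dotProduct_mulVec_zero P hlim hlim) 0

/-- The Lyapunov operator is injective on a finite-dimensional space, hence surjective. -/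
theorem IsStable.exists_lyapunov {M : Matrix ι ι ℝ} (hM : IsStable M) {R : Matrix ι ι ℝ}
    (hR : R.PosSemidef) : ∃ P : Matrix ι ι ℝ, P.PosSemidef ∧ Mᵀ * P + P * M = -R := by
  let T : Matrix ι ι ℝ →ₗ[ℝ] Matrix ι ι ℝ :=
    LinearMap.mulLeft ℝ Mᵀ + LinearMap.mulRight ℝ M
  have hT : ∀ P, T P = Mᵀ * P + P * M := fun P => rfl
  have hinj : Function.Injective T := by
    rw [← LinearMap.ker_eq_bot, LinearMap.ker_eq_bot']
    exact fun P hP => hM.lyapunov_injective hP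
  obtain ⟨P, hP⟩ := LinearMap.injective_iff_surjective.1 hinj (-R)
  have hsymm : Pᵀ = P := by
    refine hinj ?_
    have h := congrArg Matrix.transpose hP
    rw [hT, Matrix.transpose_add, Matrix.transpose_mul, Matrix.transpose_mul,
      Matrix.transpose_transpose, Matrix.transpose_neg, (posSemidef_iff_real.1 hR).1] at h
    rw [hP, hT, ← h, add_comm]
  rw [hT] at hP
  exact ⟨P, hM.posSemidef_of_lyapunov hsymm (by rwa [hP, neg_neg]), hP⟩

/-- The vectors `v`, `w` are the real and imaginary parts of a complex eigenvector. -/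
theorem exists_real_pair_of_mem_spectrum {M : Matrix ι ι ℝ} {z : ℂ}
    (hz : z ∈ spectrum ℂ (M.map Complex.ofReal)) :
    ∃ v w : ι → ℝ, (v ≠ 0 ∨ w ≠ 0) ∧ M *ᵥ v = z.re • v - z.im • w ∧
      M *ᵥ w = z.im • v + z.re • w := by
  obtain ⟨c, hc, h⟩ := mem_spectrum_iff_exists_mulVec.1 hz
  refine ⟨fun i => (c i).re, fun i => (c i).im, ?_, ?_, ?_⟩
  · by_contra! hcon
    exact hc (funext fun i => Complex.ext (congrFun hcon.1 i) (congrFun hcon.2 i))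
  · ext i
    simpa [Matrix.mulVec, dotProduct] using congrArg Complex.re (congrFun h i)
  · ext i
    simpa [Matrix.mulVec, dotProduct, add_comm] using congrArg Complex.im (congrFun h i)

theorem mem_spectrum_of_real_pair {M : Matrix ι ι ℝ} {z : ℂ} {v w : ι → ℝ}
    (hvw : v ≠ 0 ∨ w ≠ 0) (hv : M *ᵥ v = z.re • v - z.im • w)
    (hw : M *ᵥ w = z.im • v + z.re • w) : z ∈ spectrum ℂ (M.map Complex.ofReal) := by
  refine mem_spectrum_iff_exists_mulVec.2 ⟨fun i => ⟨v i, w i⟩, ?_, ?_⟩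
  · intro h
    rcases hvw with h0 | h0
    · exact h0 (funext fun i => congrArg Complex.re (congrFun h i))
    · exact h0 (funext fun i => congrArg Complex.im (congrFun h i))
  · ext i
    refine Complex.ext ?_ ?_
    · simpa [Matrix.mulVec, dotProduct] using congrFun hv i
    · simpa [Matrix.mulVec, dotProduct, add_comm] using congrFun hw i

/-! ### Limits of stable matrices -/

/-- The eigenvalues of `M` lie in the open left half-plane, so each factor `z - r` of the
characteristic polynomial at `z` has norm at least `z.re`. -/
theorem IsStable.re_pow_card_le_norm_eval_charpoly {M : Matrix ι ι ℝ} (hM : IsStable M) {z : ℂ}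
    (hz : 0 ≤ z.re) :
    z.re ^ Fintype.card ι ≤ ‖(M.map Complex.ofReal).charpoly.eval z‖ := by
  set p := (M.map Complex.ofReal).charpoly with hp
  have hsplits : p.Splits := IsAlgClosed.splits p
  have hmonic : p.Monic := Matrix.charpoly_monic _
  have heval : p.eval z = (p.roots.map fun r => z - r).prod :=
    hsplits.eval_eq_prod_roots_of_monic hmonic z
  have hcard : p.roots.card = Fintype.card ι := by
    rw [← hsplits.natDegree_eq_card_roots, hp, Matrix.charpoly_natDegree_eq_dim]
  have hle : ∀ s : Multiset ℂ, (∀ r ∈ s, z.re ≤ ‖z - r‖) →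
      z.re ^ s.card ≤ ‖(s.map fun r => z - r).prod‖ := by
    intro s
    induction s using Multiset.induction_on with
    | empty => simp
    | cons r s ih =>
      intro h
      rw [Multiset.card_cons, Multiset.map_cons, Multiset.prod_cons, norm_mul, pow_succ']
      exact mul_le_mul (h r (Multiset.mem_cons_self r s))
        (ih fun r hr => h r (Multiset.mem_cons_of_mem hr)) (pow_nonneg hz _) (norm_nonneg _)
  rw [heval, ← hcard]
  refine hle _ fun r hr => ?_
  have hr' : r.re < 0 :=
    hM r (Matrix.mem_spectrum_iff_isRoot_charpoly.2 (Polynomial.isRoot_of_mem_roots hr))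
  have := Complex.re_le_norm (z - r)
  rw [Complex.sub_re] at this
  linarith

/-- A limit of stable matrices has all its eigenvalues in the closed left half-plane: for
`0 < z.re`, the characteristic polynomials of the stable matrices are bounded away from zero
at `z`. -/
theorem re_nonpos_of_tendsto_isStable {M : ℕ → Matrix ι ι ℝ} {L : Matrix ι ι ℝ}
    (hM : ∀ k, IsStable (M k)) (hL : Tendsto M atTop (𝓝 L)) {z : ℂ}
    (hz : z ∈ spectrum ℂ (L.map Complex.ofReal)) : z.re ≤ 0 := by
  by_contra! hpos
  have hc : Continuous fun X : Matrix ι ι ℝ => ‖(X.map Complex.ofReal).charpoly.eval z‖ := by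
    simp only [Matrix.eval_charpoly]
    exact (continuous_const.sub
      (continuous_id.matrix_map Complex.continuous_ofReal)).matrix_det.norm
  have h := ge_of_tendsto' ((hc.tendsto L).comp hL) fun k =>
    (hM k).re_pow_card_le_norm_eval_charpoly hpos.le
  rw [(Matrix.mem_spectrum_iff_isRoot_charpoly.1 hz).eq_zero, norm_zero] at h
  exact (pow_pos hpos _).not_ge h

end Lyapunov

/-! ### The maximal solution of the Riccati equation -/

section Riccati

variable {ι κ : Type*} [Fintype ι] [Fintype κ]

/-- Completing the square: the closed-loop Lyapunov operator of a solution `P` of the Riccati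
equation, for an arbitrary gain `K`. -/
theorem lyapunov_of_riccati {A P : Matrix ι ι ℝ} {B : Matrix ι κ ℝ} (hsymm : Pᵀ = P)
    (hP : Aᵀ * P + P * A = P * B * Bᵀ * P) (K : Matrix κ ι ℝ) :
    (A - B * K)ᵀ * P + P * (A - B * K) =
      (Bᵀ * P - K)ᵀ * (Bᵀ * P - K) - Kᵀ * K := by
  have h : (A - B * K)ᵀ * P + P * (A - B * K) =
      (Aᵀ * P + P * A) - Kᵀ * Bᵀ * P - P * B * K := by
    simp only [Matrix.transpose_sub, Matrix.transpose_mul, Matrix.sub_mul, Matrix.mul_sub,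
      Matrix.mul_assoc]
    abel
  rw [h, hP]
  simp only [Matrix.transpose_sub, Matrix.transpose_mul, Matrix.transpose_transpose, hsymm,
    Matrix.sub_mul, Matrix.mul_sub, Matrix.mul_assoc]
  abel

/-- Replacing the gain `K` by `Bᵀ P` in the Lyapunov equation of `A - B K`. -/
theorem lyapunov_update {A P : Matrix ι ι ℝ} {B : Matrix ι κ ℝ} {K : Matrix κ ι ℝ}
    (hsymm : Pᵀ = P) (hP : (A - B * K)ᵀ * P + P * (A - B * K) = -(Kᵀ * K)) :
    (A - B * (Bᵀ * P))ᵀ * P + P * (A - B * (Bᵀ * P)) =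
      -((K - Bᵀ * P)ᵀ * (K - Bᵀ * P)) - (Bᵀ * P)ᵀ * (Bᵀ * P) := by
  have h : (A - B * (Bᵀ * P))ᵀ * P + P * (A - B * (Bᵀ * P)) =
      ((A - B * K)ᵀ * P + P * (A - B * K)) + Kᵀ * Bᵀ * P + P * B * K
        - 2 • (P * B * Bᵀ * P) := by
    simp only [Matrix.transpose_sub, Matrix.transpose_mul, Matrix.transpose_transpose, hsymm,
      Matrix.sub_mul, Matrix.mul_sub, Matrix.mul_assoc]
    abel
  rw [h, hP]
  simp only [Matrix.transpose_sub, Matrix.transpose_mul, Matrix.transpose_transpose, hsymm,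
    Matrix.sub_mul, Matrix.mul_sub, Matrix.mul_assoc]
  abel

variable [DecidableEq ι]

/-- One step of the Kleinman iteration preserves stability: an unstable eigenvector of
`A - B Bᵀ P` is annihilated by `K - Bᵀ P`, so it is an eigenvector of `A - B K` too. -/
theorem IsStable.update {A P : Matrix ι ι ℝ} {B : Matrix ι κ ℝ} {K : Matrix κ ι ℝ}
    (hK : IsStable (A - B * K)) (hPos : P.PosSemidef)
    (hP : (A - B * K)ᵀ * P + P * (A - B * K) = -(Kᵀ * K)) :
    IsStable (A - B * (Bᵀ * P)) := by
  intro z hz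
  by_contra! hre
  obtain ⟨v, w, hvw, hv, hw⟩ := exists_real_pair_of_mem_spectrum hz
  obtain ⟨h1, h2⟩ := mulVec_eq_zero_of_lyapunov (K := K - Bᵀ * P) hPos (by
    rw [lyapunov_update (posSemidef_iff_real.1 hPos).1 hP]
    convert posSemidef_transpose_mul_self (Bᵀ * P) using 1
    abel) hre hv hw
  have heq : ∀ u, (K - Bᵀ * P) *ᵥ u = 0 → (A - B * K) *ᵥ u = (A - B * (Bᵀ * P)) *ᵥ u := by
    intro u hu
    rw [Matrix.sub_mulVec, sub_eq_zero] at hu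
    rw [Matrix.sub_mulVec, Matrix.sub_mulVec, ← Matrix.mulVec_mulVec, hu, Matrix.mulVec_mulVec]
  exact absurd (hK z (mem_spectrum_of_real_pair hvw ((heq v h1).trans hv) ((heq w h2).trans hw)))
    hre.not_gt

/-- The Kleinman iteration: `P k` solves the Lyapunov equation for the gain `K k`, and the next
gain is `Bᵀ (P k)`. -/
theorem exists_kleinman_sequence {A : Matrix ι ι ℝ} {B : Matrix ι κ ℝ} {K₀ : Matrix κ ι ℝ}
    (hK₀ : IsStable (A - B * K₀)) :
    ∃ (K : ℕ → Matrix κ ι ℝ) (P : ℕ → Matrix ι ι ℝ),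
      (∀ k, IsStable (A - B * K k)) ∧ (∀ k, (P k).PosSemidef) ∧
      (∀ k, (A - B * K k)ᵀ * P k + P k * (A - B * K k) = -((K k)ᵀ * K k)) ∧
      ∀ k, K (k + 1) = Bᵀ * P k := by
  have hstep : ∀ K : {K : Matrix κ ι ℝ // IsStable (A - B * K)}, ∃ P : Matrix ι ι ℝ,
      P.PosSemidef ∧ (A - B * K.1)ᵀ * P + P * (A - B * K.1) = -(K.1ᵀ * K.1) :=
    fun K => K.2.exists_lyapunov (posSemidef_transpose_mul_self _)
  choose F hFpos hF using hstep
  let S : {K : Matrix κ ι ℝ // IsStable (A - B * K)} → {K : Matrix κ ι ℝ // IsStable (A - B * K)} :=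
    fun K => ⟨Bᵀ * F K, K.2.update (hFpos K) (hF K)⟩
  refine ⟨fun k => (S^[k] ⟨K₀, hK₀⟩).1, fun k => F (S^[k] ⟨K₀, hK₀⟩),
    fun k => (S^[k] ⟨K₀, hK₀⟩).2, fun k => hFpos _, fun k => hF _, fun k => ?_⟩
  simp only [Function.iterate_succ_apply', S]

/-- The Riccati equation of a stabilizable pair `(A, B)` has a largest positive semidefinite
solution `P`, and `A - B Bᵀ P` is stable when `A` has no eigenvalue on the imaginary axis. -/
theorem exists_maximal_riccati {A : Matrix ι ι ℝ} {B : Matrix ι κ ℝ} {K₀ : Matrix κ ι ℝ}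
    (hK₀ : IsStable (A - B * K₀))
    (hA : ∀ z ∈ spectrum ℂ (A.map Complex.ofReal), z.re ≠ 0) :
    ∃ P : Matrix ι ι ℝ, P.PosSemidef ∧ Aᵀ * P + P * A = P * B * Bᵀ * P ∧
      (∀ X : Matrix ι ι ℝ, Xᵀ = X → Aᵀ * X + X * A = X * B * Bᵀ * X → (P - X).PosSemidef) ∧
      IsStable (A - B * (Bᵀ * P)) := by
  obtain ⟨K, P, hK, hPos, hP, hKP⟩ := exists_kleinman_sequence hK₀
  have hsymm : ∀ k, (P k)ᵀ = P k := fun k => (posSemidef_iff_real.1 (hPos k)).1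
  have hanti : ∀ k, (P k - P (k + 1)).PosSemidef := by
    intro k
    refine (hK (k + 1)).posSemidef_of_lyapunov
      (by rw [Matrix.transpose_sub, hsymm, hsymm]) ?_
    have h1 := lyapunov_update (hsymm k) (hP k)
    have h2 := hP (k + 1)
    rw [← hKP k] at h1
    convert posSemidef_transpose_mul_self (K k - K (k + 1)) using 1
    rw [Matrix.mul_sub, Matrix.sub_mul, sub_add_sub_comm, h1, h2]
    abel
  obtain ⟨L, hL⟩ := exists_tendsto_of_antitone_posSemidef hPos hanti
  have hLpos := posSemidef_of_tendsto hPos hL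
  have hLsymm := (posSemidef_iff_real.1 hLpos).1
  have hM : Tendsto (fun k => A - B * (Bᵀ * P k)) atTop (𝓝 (A - B * (Bᵀ * L))) := by
    have hc : Continuous fun X : Matrix ι ι ℝ => A - B * (Bᵀ * X) :=
      continuous_const.sub (continuous_const.matrix_mul (continuous_const.matrix_mul continuous_id))
    exact (hc.tendsto L).comp hL
  -- The Lyapunov equations for `P (k + 1)`, with gain `Bᵀ (P k)`, pass to the limit.
  have hLyap : (A - B * (Bᵀ * L))ᵀ * L + L * (A - B * (Bᵀ * L)) =
      -((Bᵀ * L)ᵀ * (Bᵀ * L)) := by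
    have hc1 : Continuous fun p : Matrix ι ι ℝ × Matrix ι ι ℝ =>
        (A - B * (Bᵀ * p.1))ᵀ * p.2 + p.2 * (A - B * (Bᵀ * p.1)) + (Bᵀ * p.1)ᵀ * (Bᵀ * p.1) := by
      fun_prop
    have h := (hc1.tendsto (L, L)).comp (hL.prodMk_nhds ((tendsto_add_atTop_iff_nat 1).2 hL))
    rw [← add_eq_zero_iff_eq_neg]
    refine tendsto_nhds_unique h (tendsto_const_nhds.congr fun k => ?_)
    have h2 := hP (k + 1)
    rw [hKP k] at h2
    simp only [Function.comp_apply, h2, neg_add_cancel]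
  have hRic : Aᵀ * L + L * A = L * B * Bᵀ * L := by
    have h : Aᵀ * L + L * A = ((A - B * (Bᵀ * L))ᵀ * L + L * (A - B * (Bᵀ * L))) +
        2 • (L * B * Bᵀ * L) := by
      simp only [Matrix.transpose_sub, Matrix.transpose_mul, Matrix.transpose_transpose, hLsymm,
        Matrix.sub_mul, Matrix.mul_sub, Matrix.mul_assoc]
      abel
    rw [h, hLyap]
    simp only [Matrix.transpose_mul, Matrix.transpose_transpose, hLsymm, Matrix.mul_assoc]
    abel
  refine ⟨L, hLpos, hRic, fun X hX hXric => ?_, fun z hz => ?_⟩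
  -- Every iterate dominates every symmetric solution `X`, by completing the square.
  · refine posSemidef_of_tendsto (P := fun k => P k - X) (fun k => ?_) (hL.sub_const X)
    refine (hK k).posSemidef_of_lyapunov (by rw [Matrix.transpose_sub, hsymm, hX]) ?_
    convert posSemidef_transpose_mul_self (Bᵀ * X - K k) using 1
    rw [Matrix.mul_sub, Matrix.sub_mul, sub_add_sub_comm, hP, lyapunov_of_riccati hX hXric]
    abel
  · refine lt_of_le_of_ne (re_nonpos_of_tendsto_isStable (fun k => hKP k ▸ hK (k + 1)) hM hz) ?_
    -- On an imaginary eigenvalue the feedback `Bᵀ L` vanishes, so it is an eigenvalue of `A`.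
    intro hre
    obtain ⟨v, w, hvw, hv, hw⟩ := exists_real_pair_of_mem_spectrum hz
    obtain ⟨h1, h2⟩ := mulVec_eq_zero_of_lyapunov (K := Bᵀ * L) hLpos (by
      rw [hLyap, neg_neg, sub_self]; exact Matrix.PosSemidef.zero) hre.ge hv hw
    have heq : ∀ u, (Bᵀ * L) *ᵥ u = 0 → A *ᵥ u = (A - B * (Bᵀ * L)) *ᵥ u := by
      intro u hu
      rw [Matrix.sub_mulVec, ← Matrix.mulVec_mulVec, hu, Matrix.mulVec_zero, sub_zero]
    exact hA z (mem_spectrum_of_real_pair hvw ((heq v h1).trans hv) ((heq w h2).trans hw)) hre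

/-- A block triangular matrix with stable diagonal blocks is stable. -/
theorem IsStable.fromBlocks {ι' : Type*} [Fintype ι'] [DecidableEq ι'] {M : Matrix ι ι ℝ}
    {M' : Matrix ι' ι' ℝ} (hM : IsStable M) (hM' : IsStable M') (F : Matrix ι ι' ℝ) :
    IsStable (Matrix.fromBlocks M F 0 M') := by
  intro z hz
  rw [Matrix.mem_spectrum_iff_isRoot_charpoly, Matrix.fromBlocks_map,
    Matrix.map_zero _ Complex.ofReal_zero, Matrix.charpoly_fromBlocks_zero₂₁,
    Polynomial.root_mul] at hz
  exact hz.elim (fun h => hM z (Matrix.mem_spectrum_iff_isRoot_charpoly.2 h))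
    (fun h => hM' z (Matrix.mem_spectrum_iff_isRoot_charpoly.2 h))

end Riccati

/-! ### Output consensus -/

section Consensus

variable {N n m p : ℕ} {A : Matrix (Fin n) (Fin n) ℝ} {B : Matrix (Fin n) (Fin m) ℝ}
  {C : Matrix (Fin p) (Fin n) ℝ}

theorem eq_of_posSemidef_sub {P P' : Matrix (Fin n) (Fin n) ℝ} (h : (P - P').PosSemidef)
    (h' : (P' - P).PosSemidef) : P = P' := by
  open scoped MatrixOrder in
  exact le_antisymm (Matrix.le_iff.2 h') (Matrix.le_iff.2 h)

theorem controlRiccati_iff {P : Matrix (Fin n) (Fin n) ℝ} :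
    IsControlRiccatiSolution A B P ↔ P.PosSemidef ∧ Aᵀ * P + P * A = P * B * Bᵀ * P := by
  refine and_congr_right fun _ => ?_
  rw [show -(Aᵀ * P) - P * A + P * B * Bᵀ * P = P * B * Bᵀ * P - (Aᵀ * P + P * A) by abel,
    sub_eq_zero, eq_comm]

/-- The observer Riccati equation for `Q` is the control Riccati equation of the dual pair
`(Aᵀ, Cᵀ)` for `-Q`. -/
theorem observerRiccati_iff {Q : Matrix (Fin n) (Fin n) ℝ} :
    IsObserverRiccatiSolution A C Q ↔ IsControlRiccatiSolution Aᵀ Cᵀ (-Q) := by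
  rw [controlRiccati_iff]
  refine and_congr_right fun _ => ?_
  simp only [Matrix.transpose_transpose, Matrix.mul_neg, Matrix.neg_mul, neg_neg, ← neg_add]
  rw [neg_eq_iff_eq_neg]

theorem observerMatrix_iff {Q : Matrix (Fin n) (Fin n) ℝ} :
    IsObserverMatrix A C Q ↔ IsControlMatrix Aᵀ Cᵀ (-Q) := by
  refine and_congr observerRiccati_iff ⟨fun h P hP => ?_, fun h Q' hQ' => ?_⟩
  · have := h (-P) (observerRiccati_iff.2 (by rwa [neg_neg]))
    rwa [neg_sub_comm] at this
  · have := h (-Q') (observerRiccati_iff.1 hQ')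
    rwa [sub_neg_eq_add, neg_add_eq_sub] at this

theorem exists_controlMatrix (hAB : IsStabilizable A B) (hA : NoImaginaryAxisEigenvalue A) :
    ∃ P, IsControlMatrix A B P ∧ IsStable (A - B * (Bᵀ * P)) := by
  obtain ⟨K, hK⟩ := hAB
  have hK' : IsStable (A - B * -K) := by rwa [Matrix.mul_neg, sub_neg_eq_add]
  obtain ⟨P, hPos, hP, hmax, hstab⟩ := exists_maximal_riccati hK' hA
  refine ⟨P, ⟨controlRiccati_iff.2 ⟨hPos, hP⟩, fun X hX => ?_⟩, hstab⟩
  obtain ⟨hXpos, hXric⟩ := controlRiccati_iff.1 hX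
  exact hmax X (posSemidef_iff_real.1 hXpos).1 hXric

/-- A largest solution is unique, so it is the stabilizing one just constructed. -/
theorem IsControlMatrix.isStable {P : Matrix (Fin n) (Fin n) ℝ} (hP : IsControlMatrix A B P)
    (hAB : IsStabilizable A B) (hA : NoImaginaryAxisEigenvalue A) :
    IsStable (A - B * (Bᵀ * P)) := by
  obtain ⟨P', hP', hstab⟩ := exists_controlMatrix hAB hA
  rwa [eq_of_posSemidef_sub (hP.2 P' hP'.1) (hP'.2 P hP.1)]

theorem IsDetectable.dual (hAC : IsDetectable A C) : IsStabilizable Aᵀ Cᵀ := by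
  obtain ⟨L, hL⟩ := hAC
  refine ⟨Lᵀ, ?_⟩
  have := IsStable.transpose (M := A + L * C) hL
  rwa [Matrix.transpose_add, Matrix.transpose_mul] at this

theorem NoImaginaryAxisEigenvalue.transpose (hA : NoImaginaryAxisEigenvalue A) :
    NoImaginaryAxisEigenvalue Aᵀ :=
  fun z hz => hA z (mem_spectrum_map_transpose.1 hz)

theorem IsObserverMatrix.isStable {Q : Matrix (Fin n) (Fin n) ℝ} (hQ : IsObserverMatrix A C Q)
    (hAC : IsDetectable A C) (hA : NoImaginaryAxisEigenvalue A) :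
    IsStable (A + Q * Cᵀ * C) := by
  have h := ((observerMatrix_iff.1 hQ).isStable hAC.dual hA.transpose).transpose
  have hsymm : Qᵀ = Q := by
    have := (posSemidef_iff_real.1 hQ.1.1).1
    rwa [Matrix.transpose_neg, neg_inj] at this
  convert h using 1
  simp [Matrix.transpose_mul, Matrix.mul_assoc, hsymm]

/-- The weighted averages cancel in the difference of the measurements of two agents. -/
theorem inv_sum_smul_sum_sub {a : Fin N → ℝ} (ha : ∀ i, 0 < a i) (f : Fin N → Fin p → ℝ)
    (i j : Fin N) :
    (∑ k, a k)⁻¹ • ∑ k, a k • (f i - f k) - (∑ k, a k)⁻¹ • ∑ k, a k • (f j - f k) =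
      f i - f j := by
  have hs : ∑ k, a k ≠ 0 := (Finset.sum_pos (fun k _ => ha k) ⟨i, Finset.mem_univ i⟩).ne'
  rw [← smul_sub, ← Finset.sum_sub_distrib]
  simp only [← smul_sub, sub_sub_sub_cancel_right]
  rw [← Finset.sum_smul, smul_smul, inv_mul_cancel₀ hs, one_smul]

/-- For two agents put `z = δ i - δ j` and let `w = (x i - x j) - z` be the estimation error. Then
`(z, w)` solves a linear system with block triangular matrix, whose diagonal blocks
`A - B Bᵀ P₀` and `A + Q Cᵀ C` are stable. -/
theorem tendsto_output_sub {P₀ Q : Matrix (Fin n) (Fin n) ℝ} {a : Fin N → ℝ}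
    (ha : ∀ i, 0 < a i) (hP₀ : IsStable (A - B * (Bᵀ * P₀))) (hQ : IsStable (A + Q * Cᵀ * C))
    {t₀ : ℝ} {x : Fin N → ℝ → Fin n → ℝ} {u : Fin N → ℝ → Fin m → ℝ} {y : Fin N → ℝ → Fin p → ℝ}
    {δ : Fin N → ℝ → Fin n → ℝ} (hx : IsAgentTrajectory A B C t₀ x u y)
    (hδ : IsOutputControlLaw A B C P₀ Q a t₀ y δ u) (i j : Fin N) :
    Tendsto (fun t => y i t - y j t) atTop (𝓝 0) := by
  have hderiv : ∀ t, t₀ ≤ t → HasDerivWithinAt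
      (fun t => Sum.elim (δ i t - δ j t) ((x i t - x j t) - (δ i t - δ j t)))
      (Matrix.fromBlocks (A - B * (Bᵀ * P₀)) (-(Q * Cᵀ * C)) 0 (A + Q * Cᵀ * C) *ᵥ
        Sum.elim (δ i t - δ j t) ((x i t - x j t) - (δ i t - δ j t))) (Set.Ici t₀) t := by
    intro t ht
    have hz := (hδ.observer_eq i t ht).sub (hδ.observer_eq j t ht)
    have he := ((hx.state_eq i t ht).sub (hx.state_eq j t ht)).sub hz
    have hy := eq_add_of_sub_eq (inv_sum_smul_sum_sub ha (fun k => y k t) i j)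
    rw [hx.output_eq i t ht, hx.output_eq j t ht] at hy
    rw [Matrix.fromBlocks_mulVec]
    refine hasDerivWithinAt_pi.2 (Sum.rec (hasDerivWithinAt_pi.1 (hz.congr_deriv ?_))
      (hasDerivWithinAt_pi.1 (he.congr_deriv ?_)))
    · rw [hx.output_eq i t ht, hx.output_eq j t ht, hy]
      simp only [Function.comp_def, Sum.elim_inl, Sum.elim_inr, Matrix.sub_mulVec,
        Matrix.mulVec_sub, Matrix.mulVec_add, Matrix.neg_mulVec, ← Matrix.mulVec_mulVec]
      funext k
      simp only [Pi.add_apply, Pi.sub_apply, Pi.neg_apply]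
      ring
    · rw [hx.output_eq i t ht, hx.output_eq j t ht, hy, hδ.input_eq i t ht, hδ.input_eq j t ht]
      simp only [Function.comp_def, Sum.elim_inl, Sum.elim_inr, Matrix.sub_mulVec,
        Matrix.mulVec_sub, Matrix.mulVec_add, Matrix.neg_mulVec, Matrix.add_mulVec,
        Matrix.mulVec_neg, Matrix.zero_mulVec, ← Matrix.mulVec_mulVec]
      funext k
      simp only [Pi.add_apply, Pi.sub_apply, Pi.neg_apply, Pi.zero_apply]
      ring
  have hlim := (hP₀.fromBlocks hQ _).tendsto_zero hderiv
  have hc : Continuous fun s : Fin n ⊕ Fin n → ℝ => C *ᵥ fun k => s (Sum.inl k) + s (Sum.inr k) := by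
    fun_prop
  have h := (hc.tendsto 0).comp hlim
  simp only [Pi.zero_apply, add_zero] at h
  rw [show (fun _ : Fin n => (0 : ℝ)) = 0 from rfl, Matrix.mulVec_zero] at h
  refine h.congr' ?_
  filter_upwards [eventually_ge_atTop t₀] with t ht
  rw [hx.output_eq i t ht, hx.output_eq j t ht, ← Matrix.mulVec_sub]
  simp only [Function.comp_apply]
  congr 1
  ext k
  simp

end Consensus

end OutputConsensus

theorem proposition2 {N n m p : ℕ} (A : Matrix (Fin n) (Fin n) ℝ)
    (B : Matrix (Fin n) (Fin m) ℝ) (C : Matrix (Fin p) (Fin n) ℝ)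
    (a : Fin N → ℝ) (ha : ∀ i, 0 < a i)
    (hAB : OutputConsensus.IsStabilizable A B)
    (hAC : OutputConsensus.IsDetectable A C)
    (hA : OutputConsensus.NoImaginaryAxisEigenvalue A) :
    (∃ P₀, OutputConsensus.IsControlMatrix A B P₀) ∧
    (∃ Q, OutputConsensus.IsObserverMatrix A C Q) ∧
    ∀ P₀ Q : Matrix (Fin n) (Fin n) ℝ,
      OutputConsensus.IsControlMatrix A B P₀ →
      OutputConsensus.IsObserverMatrix A C Q →
      ∀ (t₀ : ℝ) (x : Fin N → ℝ → Fin n → ℝ) (u : Fin N → ℝ → Fin m → ℝ)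
        (y : Fin N → ℝ → Fin p → ℝ) (δ : Fin N → ℝ → Fin n → ℝ),
        OutputConsensus.IsAgentTrajectory A B C t₀ x u y →
        OutputConsensus.IsOutputControlLaw A B C P₀ Q a t₀ y δ u →
        ∀ i j, i ≠ j → Tendsto (fun t => y i t - y j t) atTop (𝓝 0) := by
  refine ⟨?_, ?_, fun P₀ Q hP₀ hQ t₀ x u y δ hx hδ i j _ => ?_⟩
  · obtain ⟨P, hP, -⟩ := OutputConsensus.exists_controlMatrix hAB hA
    exact ⟨P, hP⟩
  · obtain ⟨P, hP, -⟩ := OutputConsensus.exists_controlMatrix hAC.dual hA.transpose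
    exact ⟨-P, OutputConsensus.observerMatrix_iff.2 (by rwa [neg_neg])⟩
  · exact OutputConsensus.tendsto_output_sub ha (hP₀.isStable hAB hA) (hQ.isStable hAC hA) hx hδ i j
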